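/- For an entire function $f$ let $M(r)=\max_{|z|\le r}|f(z)|$. The order of $f$ is $\limsup_{r\to\infty}\frac{\log\log M(r)}{\log r}$ (constants, including $0$, have order $0$). For $m>0$, the type of $f$ with respect to the order $m$ is $\limsup_{r\to\infty}\frac{\log M(r)}{r^m}$, and the indicator of $f$ with respect to the order $m$ is $$H_f(\theta)=\limsup_{r\to\infty}\frac{\log|f(re^{i\theta})|}{r^m}\in[-\infty,+\infty],\qquad \theta\in\mathbb R,$$ where $\log 0=-\infty$. Let $m\ge 1$ be an integer and let $f$ be an entire function of order at most $m$ and of finite type with respect to the order $m$ (type $<+\infty$). Let $\{\lambda_n : n\ge 1\}$ be a strictly increasing sequence of positive numbers such that the (finite) limit $$a:=\lim_{n\to\infty}\frac{\lambda_n}{n^{1/m}}$$ exists. If $f(\lambda_n e^{2l\pi i/m})=0$ for all $n\ge 1$ and $0\le l\le m-1$, and $$\max_{0\le l\le m-1} H_f\Big(\frac{(4l+1)\pi}{2m}\Big)+\max_{0\le l\le m-1} H_f\Big(\frac{(4l-1)\pi}{2m}\Big)<\frac{2\pi}{a^m},$$ where the right-hand side is read as $+\infty$ if $a=0$, then $f(z)=0$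 for all $z\in\mathbb C$. -/

import Mathlib

open Filter Topology

noncomputable section

/-- The maximum modulus `M(r)`: the maximum of `|f|` on the closed disc `|z| ≤ r`
(attained when `f` is continuous and `0 ≤ r`). -/
def maxModulus (f : ℂ → ℂ) (r : ℝ) : ℝ :=
  sSup ((fun z : ℂ => ‖f z‖) '' Metric.closedBall 0 r)

/-- The order `limsup_{r → ∞} log log M(r) / log r` of an entire function, an extended real.
For constant functions, zero included, this gives the usual convention: order `0`. -/
def entireOrder (f : ℂ → ℂ) : EReal :=
  limsup (fun r : ℝ =>
    ((Real.log (Real.log (maxModulus f r)) / Real.log r : ℝ) : EReal)) atTop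

/-- The type `limsup_{r → ∞} log M(r) / r ^ ϱ` of an entire function with respect to the
order `ϱ`, an extended real. -/
def entireType (ϱ : ℝ) (f : ℂ → ℂ) : EReal :=
  limsup (fun r : ℝ => ((Real.log (maxModulus f r) / r ^ ϱ : ℝ) : EReal)) atTop

/-- The indicator `H_f(θ) = limsup_{r → ∞} log |f(r e^{iθ})| / r ^ ϱ` of `f` with respect to the
order `ϱ`. Both the logarithm and the limsup take values in the extended reals, so that
`log |f(z)| = -∞` at the zeros of `f`. -/
def indicatorFn (ϱ : ℝ) (f : ℂ → ℂ) (θ : ℝ) : EReal :=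
  limsup (fun r : ℝ =>
    ENNReal.log ‖f (r * Complex.exp (θ * Complex.I))‖ₑ / ((r ^ ϱ : ℝ) : EReal)) atTop

end

/-! The substitution k(w) = f(w^{1/m}) turns the sector |arg z| ≤ π/(2m) into the right half-plane.
There k has exponential type, grows along the two halves of the imaginary axis at most at rates c₁,
c₂ exceeding H_f(±π/(2m)), and vanishes at μ_n = λ_n^m, where D μ_n ≤ n eventually as soon as D a^m
< 1. The indicator condition leaves room for c₁ + c₂ < 2πD, so the claim reduces to a form of
Carlson's theorem, `eq_zero_of_positive_zeros`.

For that theorem, a factor e^{ibw} makes both rates equal to c = (c₁ + c₂)/2, and Phragmén–Lindelöf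
gives |k| ≤ C exp(c|y| + Tx). Multiplying k by exp(K w log w - L w), with K = 2c/π and L = K log R +
O(1), makes it bounded by C on the disc |w - R| < R. The Blaschke product over the μ_n with n ≤ DR
then bounds the product at a fixed p by C exp(-2p Σ 1/μ_n + O(1)), and Σ 1/μ_n ≥ D log R - O(1). If
k(p) ≠ 0, this yields (2D - K) p log R ≤ O(1), which fails for large R because c < πD means K < 2D.
Hence f vanishes on (0, λ_1), and the identity theorem finishes. -/

/-! ### Blaschke products and harmonic sums -/

/-- If a bounded analytic function on the unit disc vanishes at `s`, then dividing it by the Blaschke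
factor of `s` does not increase its supremum. -/
theorem exists_eq_mul_blaschke_factor {F : ℂ → ℂ} {M : ℝ}
    (hF : DifferentiableOn ℂ F (Metric.ball 0 1)) (hM : ∀ z ∈ Metric.ball (0 : ℂ) 1, ‖F z‖ ≤ M)
    {s : ℝ} (hs : |s| < 1) (h0 : F s = 0) :
    ∃ F₁ : ℂ → ℂ, DifferentiableOn ℂ F₁ (Metric.ball 0 1) ∧
      (∀ z ∈ Metric.ball (0 : ℂ) 1, ‖F₁ z‖ ≤ M) ∧
      ∀ z, (1 - s * z) * F z = (z - s) * F₁ z := by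
  have hsb : (s : ℂ) ∈ Metric.ball (0 : ℂ) 1 := by simpa using hs
  have hd : DifferentiableOn ℂ (fun z => (1 - s * z) * dslope F s z) (Metric.ball 0 1) := by
    refine DifferentiableOn.mul (by fun_prop) ?_
    exact (Complex.differentiableOn_dslope (Metric.isOpen_ball.mem_nhds hsb)).2 hF
  have hfac : ∀ z, (1 - s * z) * F z = (z - s) * ((1 - s * z) * dslope F s z) := by
    intro z
    have := sub_smul_dslope F (s : ℂ) z
    rw [h0, sub_zero, smul_eq_mul] at this
    rw [← this]; ring
  refine ⟨_, hd, ?_, hfac⟩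
  have hM0 : 0 ≤ M := (norm_nonneg _).trans (hM s hsb)
  -- the pointwise identity `|z - s|² = |1 - s z|² - (1 - s²) (1 - |z|²)`
  have hid : ∀ z : ℂ, ‖z - s‖ ^ 2 = ‖1 - s * z‖ ^ 2 - (1 - s ^ 2) * (1 - ‖z‖ ^ 2) := by
    intro z
    simp only [← Complex.normSq_eq_norm_sq, Complex.normSq_apply]
    simp
    ring
  have hlow : ∀ z : ℂ, ‖z‖ ≤ 1 → 1 - |s| ≤ ‖1 - s * z‖ := by
    intro z hz
    have h1 : ‖(1 : ℂ)‖ - ‖(s : ℂ) * z‖ ≤ ‖1 - s * z‖ := norm_sub_norm_le _ _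
    simp only [norm_one, norm_mul, Complex.norm_real, Real.norm_eq_abs] at h1
    nlinarith [abs_nonneg s, norm_nonneg z]
  have hs2 : s ^ 2 < 1 := by rw [← sq_abs]; nlinarith [abs_nonneg s]
  intro z hz
  -- the estimate on the circle of radius `r`
  set ε : ℝ → ℝ := fun r => (1 - s ^ 2) * (1 - r ^ 2) / (1 - |s|) ^ 2 with hε
  -- F has no boundary values, so the maximum principle is used on |z| = r < 1. There the Blaschke
  -- factor is at least √(1 - ε r), and the loss disappears as r → 1.
  have hεlim : Tendsto (fun r => M / √(1 - ε r)) (𝓝[<] 1) (𝓝 M) := by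
    have hc : ContinuousAt (fun r => M / √(1 - ε r)) 1 := by
      have : ContinuousAt ε 1 := by simp only [hε]; fun_prop
      refine ContinuousAt.div continuousAt_const (by fun_prop) ?_
      simp [hε]
    have := hc.tendsto
    simp only [hε, one_pow, sub_self, mul_zero, zero_div, sub_zero, Real.sqrt_one, div_one] at this
    exact this.mono_left nhdsWithin_le_nhds
  refine ge_of_tendsto hεlim ?_
  have hz1 : ‖z‖ < 1 := by simpa using hz
  have hε1 : ∀ᶠ r in 𝓝[<] (1 : ℝ), ε r < 1 := by
    have : ContinuousAt ε 1 := by simp only [hε]; fun_prop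
    refine (this.eventually_lt continuousAt_const ?_).filter_mono nhdsWithin_le_nhds
    simp [hε]
  filter_upwards [hε1, Ioo_mem_nhdsLT (show max ‖z‖ 0 < 1 by simpa using hz1)] with r hr1 hr
  have hr0 : 0 < r := (le_max_right _ _).trans_lt hr.1
  have hzr : ‖z‖ < r := (le_max_left _ _).trans_lt hr.1
  refine Complex.norm_le_of_forall_mem_frontier_norm_le (U := Metric.ball 0 r)
    (f := fun z => (1 - s * z) * dslope F s z)
    Metric.isBounded_ball ?_ ?_ (subset_closure (by simpa using hzr))
  · exact (hd.mono (Metric.closedBall_subset_ball hr.2)).diffContOnCl_ball le_rfl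
  · intro w hw
    rw [frontier_ball _ hr0.ne'] at hw
    have hwr : ‖w‖ = r := by simpa using hw
    have hq : 0 < ‖1 - s * w‖ := lt_of_lt_of_le (by linarith) (hlow w (by linarith [hr.2]))
    have h1 : (1 - ε r) * ‖1 - s * w‖ ^ 2 ≤ ‖w - s‖ ^ 2 := by
      have : (1 - s ^ 2) * (1 - r ^ 2) ≤ ε r * ‖1 - s * w‖ ^ 2 := by
        have h2 : (1 - |s|) ^ 2 ≤ ‖1 - s * w‖ ^ 2 :=
          pow_le_pow_left₀ (by linarith) (hlow w (by linarith [hr.2])) 2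
        have h3 : 0 ≤ (1 - s ^ 2) * (1 - r ^ 2) :=
          mul_nonneg (by linarith) (by nlinarith [hr.2])
        simp only [hε]
        rw [div_mul_eq_mul_div, le_div_iff₀ (by have : 0 < 1 - |s| := by linarith
                                                positivity)]
        exact mul_le_mul_of_nonneg_left h2 h3
      rw [hid w, hwr]; linarith
    have h2 : √(1 - ε r) * ‖1 - s * w‖ ≤ ‖w - s‖ := by
      rw [← Real.sqrt_sq (norm_nonneg (w - s)), ← Real.sqrt_sq (norm_nonneg (1 - s * w)),
        ← Real.sqrt_mul (by linarith)]
      exact Real.sqrt_le_sqrt h1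
    have hsq : 0 < √(1 - ε r) := Real.sqrt_pos.2 (by linarith)
    have h3 := congrArg norm (hfac w)
    rw [norm_mul, norm_mul] at h3
    have h4 : ‖F w‖ ≤ M := hM w (by simpa [hwr] using hr.2)
    rw [le_div_iff₀ hsq]
    set X := ‖(1 - s * w) * dslope F s w‖
    have hX : 0 ≤ X := norm_nonneg _
    have h5 : (X * √(1 - ε r)) * ‖1 - s * w‖ ≤ M * ‖1 - s * w‖ := by
      calc _ = (√(1 - ε r) * ‖1 - s * w‖) * X := by ring
        _ ≤ ‖w - s‖ * X := mul_le_mul_of_nonneg_right h2 hX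
        _ = ‖1 - s * w‖ * ‖F w‖ := h3.symm
        _ ≤ _ := by rw [mul_comm]; exact mul_le_mul_of_nonneg_right h4 hq.le
    exact le_of_mul_le_mul_right h5 hq

/-- A function bounded by `M` on the unit disc is bounded by `M` times the finite Blaschke product
of its zeros (here: real zeros, real argument). -/
theorem norm_le_mul_prod_blaschke (S : Finset ℝ) {F : ℂ → ℂ} {M : ℝ}
    (hF : DifferentiableOn ℂ F (Metric.ball 0 1)) (hM : ∀ z ∈ Metric.ball (0 : ℂ) 1, ‖F z‖ ≤ M)
    (hS : ∀ s ∈ S, |s| < 1 ∧ F s = 0) {x : ℝ} (hx : |x| < 1) :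
    ‖F x‖ ≤ M * ∏ s ∈ S, (|x - s| / |1 - s * x|) := by
  induction S using Finset.induction_on generalizing F with
  | empty => simpa using hM x (by simpa using hx)
  | insert s S hsS ih =>
    obtain ⟨hs, h0⟩ := hS s (Finset.mem_insert_self _ _)
    obtain ⟨F₁, hd, hb, hfac⟩ := exists_eq_mul_blaschke_factor hF hM hs h0
    -- Since t ≠ s, the zero of F at t is inherited by F₁.
    have key := ih hd hb (fun t ht => by
      obtain ⟨ht1, ht0⟩ := hS t (Finset.mem_insert_of_mem ht)
      refine ⟨ht1, ?_⟩
      have h := hfac t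
      rw [ht0, mul_zero, eq_comm, mul_eq_zero] at h
      refine h.resolve_left fun h => hsS ?_
      have : t = s := by exact_mod_cast sub_eq_zero.1 h
      exact this ▸ ht)
    rw [Finset.prod_insert hsS]
    have hq : 0 < |1 - s * x| := by
      have h : |s * x| < 1 := by
        rw [abs_mul]; nlinarith [abs_nonneg s, abs_nonneg x]
      exact abs_pos.2 (by linarith [(abs_lt.1 h).2])
    have h := congrArg norm (hfac x)
    rw [norm_mul, norm_mul] at h
    have e1 : ‖(1 : ℂ) - s * x‖ = |1 - s * x| := by
      rw [← Real.norm_eq_abs, ← Complex.norm_real]; simp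
    have e2 : ‖(x : ℂ) - s‖ = |x - s| := by
      rw [← Real.norm_eq_abs, ← Complex.norm_real]; simp
    rw [e1, e2] at h
    have : ‖F x‖ = |x - s| / |1 - s * x| * ‖F₁ x‖ := by
      rw [div_mul_eq_mul_div, eq_div_iff hq.ne']; linarith
    rw [this]
    calc _ ≤ |x - s| / |1 - s * x| * (M * ∏ t ∈ S, (|x - t| / |1 - t * x|)) := by gcongr
      _ = _ := by ring

/-- The Blaschke factor of the disc `|w - R| < R` with zero `μ`, at a point `p < μ`. -/
theorem blaschke_factor_le_exp {p μ R : ℝ} (hp : 0 < p) (hpμ : p < μ) (hμR : μ ≤ R) :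
    |(p - R) / R - (μ - R) / R| / |1 - (μ - R) / R * ((p - R) / R)|
      ≤ Real.exp (-(2 * p / μ - p / R)) := by
  have hR : 0 < R := by linarith
  have hμ : 0 < μ := by linarith
  have hden : 0 < R * μ + p * R - p * μ := by nlinarith
  have e : |(p - R) / R - (μ - R) / R| / |1 - (μ - R) / R * ((p - R) / R)|
      = R * (μ - p) / (R * μ + p * R - p * μ) := by
    have e1 : (p - R) / R - (μ - R) / R = -((μ - p) / R) := by ring
    have e2 : 1 - (μ - R) / R * ((p - R) / R) = (R * μ + p * R - p * μ) / R ^ 2 := by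
      field_simp; ring
    rw [e1, e2, abs_neg, abs_of_pos (div_pos (by linarith) hR), abs_of_pos (by positivity)]
    field_simp
  rw [e]
  have hpos : 0 < R * (μ - p) / (R * μ + p * R - p * μ) :=
    div_pos (mul_pos hR (by linarith)) hden
  rw [← Real.log_le_iff_le_exp hpos]
  -- The factor equals 1/(1 + t), and log(1 + t) ≥ 2t/(t + 2) gives the exponent.
  set t : ℝ := p * (2 * R - μ) / (R * (μ - p)) with ht
  have hmp : 0 < μ - p := by linarith
  have ht0 : 0 ≤ t := div_nonneg (mul_nonneg hp.le (by linarith)) (by positivity)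
  have hinv : R * (μ - p) / (R * μ + p * R - p * μ) = (1 + t)⁻¹ := by
    have : 1 + t = (R * μ + p * R - p * μ) / (R * (μ - p)) := by
      rw [ht]; field_simp; ring
    rw [this, inv_div]
  rw [hinv, Real.log_inv, neg_le_neg_iff]
  refine le_trans ?_ (Real.le_log_one_add_of_nonneg ht0)
  have hd2 : 0 < 2 * R * μ - p * μ := by nlinarith
  have e3 : 2 * t / (t + 2) = 2 * (p * (2 * R - μ)) / (2 * R * μ - p * μ) := by
    have : t + 2 = (2 * R * μ - p * μ) / (R * (μ - p)) := by
      rw [ht]; field_simp; ring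
    rw [this, ht]; field_simp
  have e4 : 2 * p / μ - p / R = p * (2 * R - μ) / (R * μ) := by field_simp
  rw [e3, e4, div_le_div_iff₀ (by positivity) hd2]
  have : 0 ≤ p * (2 * R - μ) := mul_nonneg hp.le (by linarith)
  nlinarith [mul_pos hp hμ]

/-- A harmonic sum over `[n₀, D R]` is at least `log R` up to a constant. -/
theorem exists_log_sub_le_sum_inv {D : ℝ} (hD : 0 < D) (n₀ : ℕ) :
    ∃ B : ℝ, ∀ R : ℝ, 0 < R →
      Real.log R - B ≤ ∑ k ∈ Finset.Icc n₀ ⌊D * R⌋₊, ((k : ℝ))⁻¹ := by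
  refine ⟨(∑ k ∈ Finset.range n₀, ((k : ℝ))⁻¹) - Real.log D, fun R hR => ?_⟩
  have h1 := log_le_harmonic_floor (D * R) (by positivity)
  rw [Real.log_mul hD.ne' hR.ne', harmonic_eq_sum_Icc] at h1
  push_cast at h1
  have h2 : ∑ k ∈ Finset.Icc 1 ⌊D * R⌋₊, ((k : ℝ))⁻¹ ≤
      ∑ k ∈ Finset.range n₀ ∪ Finset.Icc n₀ ⌊D * R⌋₊, ((k : ℝ))⁻¹ := by
    refine Finset.sum_le_sum_of_subset_of_nonneg (fun k hk => ?_) (fun _ _ _ => by positivity)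
    simp only [Finset.mem_union, Finset.mem_range, Finset.mem_Icc] at hk ⊢
    omega
  have h3 : ∑ k ∈ Finset.range n₀ ∪ Finset.Icc n₀ ⌊D * R⌋₊, ((k : ℝ))⁻¹ =
      ∑ k ∈ Finset.range n₀, ((k : ℝ))⁻¹ + ∑ k ∈ Finset.Icc n₀ ⌊D * R⌋₊, ((k : ℝ))⁻¹ := by
    refine Finset.sum_union (Finset.disjoint_left.2 fun k hk hk' => ?_)
    simp only [Finset.mem_range, Finset.mem_Icc] at hk hk'
    omega
  linarith

/-! ### Phragmén–Lindelöf in the right half-plane -/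

/-- Phragmén–Lindelöf bound in the closed right half-plane for a function of exponential type with
growth at most `exp (c |y|)` on the imaginary axis. -/
theorem norm_le_mul_exp_of_exponential_type {k : ℂ → ℂ} {C T c : ℝ}
    (hd : DifferentiableOn ℂ k {z | 0 < z.re}) (hc : ContinuousOn k {z | 0 ≤ z.re})
    (hT : ∀ z : ℂ, 0 ≤ z.re → ‖k z‖ ≤ C * Real.exp (T * ‖z‖))
    (hI : ∀ y : ℝ, ‖k (y * Complex.I)‖ ≤ C * Real.exp (c * |y|))
    {z : ℂ} (hz : 0 ≤ z.re) : ‖k z‖ ≤ C * Real.exp (c * |z.im| + T * z.re) := by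
  have hC : 0 ≤ C := by simpa using (norm_nonneg _).trans (hT 0 (by simp))
  -- the common part of the two quadrants, with `σ = ±1`
  have hnorm : ∀ (σ : ℝ) (w : ℂ),
      ‖k w * Complex.exp (σ * c * Complex.I * w - T * w)‖ =
        ‖k w‖ * Real.exp (-(σ * c * w.im) - T * w.re) := by
    intro σ w
    rw [norm_mul, Complex.norm_exp]
    congr 2
    simp
  have hgrow : ∀ (σ : ℝ), |σ| ≤ 1 → ∀ s : Set ℂ, s ⊆ {z | 0 < z.re} → ∃ e < (2 : ℝ), ∃ B : ℝ,
      (fun w => k w * Complex.exp (σ * c * Complex.I * w - T * w))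
        =O[Bornology.cobounded ℂ ⊓ 𝓟 s] fun w => Real.exp (B * ‖w‖ ^ e) := by
    intro σ hσ s hs
    -- Growth of order 1 lies below the critical exponent 2 of a quadrant.
    refine ⟨1, by norm_num, T + |c| + |T|, Asymptotics.IsBigO.of_bound C ?_⟩
    filter_upwards [mem_inf_of_right (mem_principal_self s)] with w hw
    rw [hnorm, Real.norm_eq_abs, Real.abs_exp, Real.rpow_one]
    have h1 : -(σ * c * w.im) ≤ |c| * ‖w‖ := by
      refine (neg_le_abs _).trans ?_
      rw [abs_mul, abs_mul]
      have := Complex.abs_im_le_norm w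
      have h2 : |σ| * |c| ≤ |c| := by nlinarith [abs_nonneg c]
      exact mul_le_mul h2 this (abs_nonneg _) (abs_nonneg _)
    have h2 : -(T * w.re) ≤ |T| * ‖w‖ := by
      refine (neg_le_abs _).trans ?_
      rw [abs_mul]
      exact mul_le_mul_of_nonneg_left (Complex.abs_re_le_norm w) (abs_nonneg _)
    calc _ ≤ C * Real.exp (T * ‖w‖) * Real.exp (-(σ * c * w.im) - T * w.re) := by
          gcongr; exact hT w (le_of_lt (show 0 < w.re from hs hw))
      _ = C * Real.exp (T * ‖w‖ + (-(σ * c * w.im) - T * w.re)) := by rw [mul_assoc, Real.exp_add]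
      _ ≤ _ := by gcongr; linarith
  -- The multiplier has modulus exp(-σcy - Tx): it cancels the type on the positive axis and the
  -- rate c on the half of the imaginary axis where σy = |y|.
  have hre : ∀ (σ : ℝ) (x : ℝ), 0 ≤ x →
      ‖k x * Complex.exp (σ * c * Complex.I * x - T * x)‖ ≤ C := by
    intro σ x hx
    rw [hnorm]
    have := hT x (by simpa using hx)
    rw [Complex.norm_real, Real.norm_eq_abs, abs_of_nonneg hx] at this
    calc _ ≤ C * Real.exp (T * x) * Real.exp (-(T * x)) := by
          simp only [Complex.ofReal_im, Complex.ofReal_re, mul_zero, neg_zero, zero_sub]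
          gcongr
      _ = C := by rw [mul_assoc, ← Real.exp_add]; simp
  have him : ∀ (σ : ℝ) (y : ℝ), σ * y = |y| →
      ‖k (y * Complex.I) * Complex.exp (σ * c * Complex.I * (y * Complex.I) - T * (y * Complex.I))‖
        ≤ C := by
    intro σ y hy
    rw [hnorm]
    calc _ ≤ C * Real.exp (c * |y|) * Real.exp (-(c * |y|)) := by
          gcongr
          · exact hI y
          · simp [← hy]; linarith
      _ = C := by rw [mul_assoc, ← Real.exp_add]; simp
  have hdc : ∀ (σ : ℝ) (s : Set ℂ), s ⊆ {z | 0 < z.re} →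
      DiffContOnCl ℂ (fun w => k w * Complex.exp (σ * c * Complex.I * w - T * w)) s := by
    intro σ s hs
    have hcl : closure s ⊆ {z | 0 ≤ z.re} :=
      closure_minimal (fun w hw => le_of_lt (show 0 < w.re from hs hw)) (isClosed_le continuous_const Complex.continuous_re)
    exact ⟨(hd.mono hs).mul (by fun_prop), (hc.mono hcl).mul (by fun_prop)⟩
  have hfin : ∀ (σ : ℝ), σ * z.im = |z.im| →
      ‖k z * Complex.exp (σ * c * Complex.I * z - T * z)‖ ≤ C →
      ‖k z‖ ≤ C * Real.exp (c * |z.im| + T * z.re) := by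
    intro σ hσ h
    rw [hnorm, show -(σ * c * z.im) - T * z.re = -(c * |z.im| + T * z.re) by rw [← hσ]; ring,
      Real.exp_neg, ← div_eq_mul_inv, div_le_iff₀ (Real.exp_pos _)] at h
    exact h
  rcases le_total 0 z.im with hi | hi
  · refine hfin 1 (by rw [abs_of_nonneg hi, one_mul]) ?_
    exact PhragmenLindelof.quadrant_I 
      (f := fun w => k w * Complex.exp ((1 : ℝ) * c * Complex.I * w - T * w)) (hdc 1 _ fun w hw => hw.1)
      (hgrow 1 (by simp) _ fun w hw => hw.1) (fun x hx => hre 1 x hx)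
      (fun y hy => him 1 y (by rw [abs_of_nonneg hy, one_mul])) hz hi
  · refine hfin (-1) (by rw [abs_of_nonpos hi]; ring) ?_
    exact PhragmenLindelof.quadrant_IV 
      (f := fun w => k w * Complex.exp (((-1) : ℝ) * c * Complex.I * w - T * w)) (hdc (-1) _ fun w hw => hw.1)
      (hgrow (-1) (by simp) _ fun w hw => hw.1) (fun x hx => hre (-1) x hx)
      (fun y hy => him (-1) y (by rw [abs_of_nonpos hy]; ring)) hz hi

/-- On the right half-plane, `|y| ≤ (2 / π) y arg z + x`. -/
theorem abs_im_le_arg_mul_im_add_re {z : ℂ} (hz : 0 < z.re) :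
    |z.im| ≤ 2 / Real.pi * (z.im * z.arg) + z.re := by
  have harg : |z.arg| ≤ Real.pi / 2 := (Complex.abs_arg_lt_pi_div_two_iff.2 (Or.inl hz)).le
  -- Concavity bound cos t ≥ 1 - 2t/π on [0, π/2].
  have h1 := Real.one_sub_mul_le_cos (abs_nonneg z.arg) harg
  rw [Real.cos_abs] at h1
  have him : z.im * z.arg = |z.im| * |z.arg| := by
    rw [← abs_mul, abs_of_nonneg]
    rcases le_total 0 z.im with h | h
    · exact mul_nonneg h (Complex.arg_nonneg_iff.2 h)
    · rcases h.lt_or_eq with h | h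
      · exact mul_nonneg_of_nonpos_of_nonpos h.le (Complex.arg_neg_iff.2 h).le
      · simp [h]
  have hre : z.re = ‖z‖ * Real.cos z.arg := (Complex.norm_mul_cos_arg z).symm
  have hle : |z.im| ≤ ‖z‖ := Complex.abs_im_le_norm z
  rw [him]
  have h2 : |z.im| * (1 - 2 / Real.pi * |z.arg|) ≤ ‖z‖ * (1 - 2 / Real.pi * |z.arg|) := by
    refine mul_le_mul_of_nonneg_right hle ?_
    have : 2 / Real.pi * |z.arg| ≤ 2 / Real.pi * (Real.pi / 2) := by gcongr
    have h3 : 2 / Real.pi * (Real.pi / 2) = 1 := by field_simp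
    linarith
  have h3 : ‖z‖ * (1 - 2 / Real.pi * |z.arg|) ≤ z.re := by
    rw [hre]; exact mul_le_mul_of_nonneg_left h1 (norm_nonneg z)
  linarith

/-! ### Carlson's theorem -/

/-- Carlson's theorem in the right half-plane, for symmetric growth on the imaginary axis and
positive zeros of lower density at least `D`. -/
theorem eq_zero_of_positive_zeros_of_symmetric_growth {k : ℂ → ℂ} {C T c D : ℝ}
    (hd : DifferentiableOn ℂ k {z | 0 < z.re}) (hc : ContinuousOn k {z | 0 ≤ z.re})
    (hT : ∀ z : ℂ, 0 ≤ z.re → ‖k z‖ ≤ C * Real.exp (T * ‖z‖))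
    (hI : ∀ y : ℝ, ‖k (y * Complex.I)‖ ≤ C * Real.exp (c * |y|))
    (hc0 : 0 ≤ c) (hcD : c < Real.pi * D)
    {μ : ℕ → ℝ} {n₀ : ℕ} (hinj : Set.InjOn μ (Set.Ici n₀)) (hμ0 : ∀ n, n₀ ≤ n → k (μ n) = 0)
    (hμD : ∀ n, n₀ ≤ n → D * μ n ≤ n)
    {p : ℝ} (hp : 0 < p) (hpμ : ∀ n, n₀ ≤ n → p < μ n) : k p = 0 := by
  by_contra hkp
  have hD : 0 < D := pos_of_mul_pos_right (hc0.trans_lt hcD) Real.pi_pos.le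
  -- With this K, the term K y arg w dominates c|y| up to an error c x.
  set K : ℝ := 2 * c / Real.pi with hK
  have hK0 : 0 ≤ K := by positivity
  have hKD : K < 2 * D := by
    rw [hK, div_lt_iff₀ Real.pi_pos]; linarith
  have hC : 0 < C := by
    have h := (norm_pos_iff.2 hkp).trans_le (hT p (by simpa using hp.le))
    exact pos_of_mul_pos_left h (Real.exp_pos _).le
  obtain ⟨B, hB⟩ := exists_log_sub_le_sum_inv hD n₀
  -- the estimate at scale `R`
  have key : ∀ R : ℝ, p < R → (2 * D - K) * p * Real.log R ≤
      Real.log C - Real.log ‖k p‖ - K * p * Real.log p + (T + c + K * Real.log 2) * p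
        + 2 * p * D * B + p * D + 1 := by
    intro R hpR
    have hR : 0 < R := hp.trans hpR
    -- L absorbs the type T, the error c x and K x log|w|, as |w| ≤ 2R on the disc.
    set L : ℝ := T + c + K * Real.log (2 * R) with hL
    set G : ℂ → ℂ := fun w => k w * Complex.exp (K * (w * Complex.log w) - L * w) with hG
    have hGnorm : ∀ w : ℂ, ‖G w‖ =
        ‖k w‖ * Real.exp (K * (w.re * Real.log ‖w‖ - w.im * w.arg) - L * w.re) := by
      intro w
      simp only [hG]
      rw [norm_mul, Complex.norm_exp]
      congr 2
      simp [Complex.log_re, Complex.log_im]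
    have hGb : ∀ w : ℂ, 0 < w.re → ‖w‖ ≤ 2 * R → ‖G w‖ ≤ C := by
      intro w hw hwR
      rw [hGnorm]
      have h1 := norm_le_mul_exp_of_exponential_type hd hc hT hI hw.le
      have hw0 : 0 < ‖w‖ := norm_pos_iff.2 fun h => by simp [h] at hw
      have h2 : K * (w.re * Real.log ‖w‖) ≤ K * (w.re * Real.log (2 * R)) := by gcongr
      have h3 : c * |w.im| ≤ K * (w.im * w.arg) + c * w.re := by
        calc c * |w.im| ≤ c * (2 / Real.pi * (w.im * w.arg) + w.re) :=
              mul_le_mul_of_nonneg_left (abs_im_le_arg_mul_im_add_re hw) hc0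
          _ = _ := by rw [hK]; ring
      calc _ ≤ C * Real.exp (c * |w.im| + T * w.re) *
            Real.exp (K * (w.re * Real.log ‖w‖ - w.im * w.arg) - L * w.re) := by gcongr
        _ = C * Real.exp (c * |w.im| + T * w.re +
            (K * (w.re * Real.log ‖w‖ - w.im * w.arg) - L * w.re)) := by
          rw [mul_assoc, ← Real.exp_add]
        _ ≤ C * Real.exp 0 := by
          gcongr
          rw [hL]; linarith
        _ = C := by simp
    -- transport to the unit disc
    have hball : ∀ z ∈ Metric.ball (0 : ℂ) 1, 0 < ((R : ℂ) + R * z).re ∧ ‖(R : ℂ) + R * z‖ ≤ 2 * R := by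
      intro z hz
      have hz1 : ‖z‖ < 1 := by simpa using hz
      constructor
      · have := (abs_le.1 (Complex.abs_re_le_norm z)).1
        simp only [Complex.add_re, Complex.ofReal_re, Complex.mul_re, Complex.ofReal_im, zero_mul,
          sub_zero]
        nlinarith
      · refine (norm_add_le _ _).trans ?_
        rw [norm_mul, Complex.norm_real, Real.norm_eq_abs, abs_of_pos hR]
        nlinarith
    have hFd : DifferentiableOn ℂ (fun z : ℂ => G (R + R * z)) (Metric.ball 0 1) := by
      have hGd : DifferentiableOn ℂ G {z | 0 < z.re} := by
        refine hd.mul ?_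
        refine DifferentiableOn.cexp (DifferentiableOn.sub (DifferentiableOn.const_mul
          (differentiableOn_id.mul ?_) _) (by fun_prop))
        exact differentiableOn_id.clog fun w hw => Or.inl hw
      exact hGd.comp (by fun_prop) fun z hz => (hball z hz).1
    have hcast : ∀ x : ℝ, (R : ℂ) + R * (((x - R) / R : ℝ) : ℂ) = x := by
      intro x
      rw [← Complex.ofReal_mul, mul_div_cancel₀ _ hR.ne', ← Complex.ofReal_add]
      simp
    have habs : ∀ x : ℝ, 0 < x → x ≤ R → |(x - R) / R| < 1 := by
      intro x hx hxR
      rw [abs_lt, lt_div_iff₀ hR, div_lt_iff₀ hR]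
      constructor <;> linarith
    -- For n ≤ DR, the bound D μ_n ≤ n forces μ_n ≤ R, placing the zero in the disc.
    set N : Finset ℕ := Finset.Icc n₀ ⌊D * R⌋₊ with hN
    have hNmem : ∀ n ∈ N, n₀ ≤ n ∧ (n : ℝ) ≤ D * R := by
      intro n hn
      rw [hN, Finset.mem_Icc] at hn
      exact ⟨hn.1, (Nat.le_floor_iff (by positivity)).1 hn.2⟩
    have hμR : ∀ n ∈ N, μ n ≤ R := by
      intro n hn
      obtain ⟨h1, h2⟩ := hNmem n hn
      exact le_of_mul_le_mul_left ((hμD n h1).trans h2) hD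
    have hmain := norm_le_mul_prod_blaschke (N.image fun n => (μ n - R) / R) hFd
      (fun z hz => hGb _ (hball z hz).1 (hball z hz).2)
      (fun s hs => by
        obtain ⟨n, hn, rfl⟩ := Finset.mem_image.1 hs
        refine ⟨habs _ (hp.trans (hpμ n (hNmem n hn).1)) (hμR n hn), ?_⟩
        simp only [hcast, hG]
        rw [hμ0 n (hNmem n hn).1, zero_mul])
      (habs p hp hpR.le)
    rw [Finset.prod_image (by
      intro a ha b hb hab
      refine hinj (hNmem a ha).1 (hNmem b hb).1 ?_
      have := (div_left_inj' hR.ne').1 hab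
      linarith)] at hmain
    simp only [hcast] at hmain
    have hprod : ∏ n ∈ N, (|(p - R) / R - (μ n - R) / R| /
        |1 - (μ n - R) / R * ((p - R) / R)|) ≤
        Real.exp (∑ n ∈ N, -(2 * p / μ n - p / R)) := by
      rw [Real.exp_sum]
      refine Finset.prod_le_prod (fun _ _ => by positivity) fun n hn => ?_
      exact blaschke_factor_le_exp hp (hpμ n (hNmem n hn).1) (hμR n hn)
    have hsum : ∑ n ∈ N, -(2 * p / μ n - p / R) ≤
        -(2 * p * D * (Real.log R - B)) + p * D + 1 := by
      -- Here 1/μ_n ≥ D/n, and the corrections p/R, at most DR + 1 in number, add up to O(1).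
      have h1 : ∀ n ∈ N, -(2 * p / μ n - p / R) ≤ -(2 * p * D) * ((n : ℝ))⁻¹ + p / R := by
        intro n hn
        have hμpos : 0 < μ n := hp.trans (hpμ n (hNmem n hn).1)
        have hle := hμD n (hNmem n hn).1
        have hn0 : (0 : ℝ) < n := lt_of_lt_of_le (mul_pos hD hμpos) hle
        have : 2 * p * D * ((n : ℝ))⁻¹ ≤ 2 * p / μ n := by
          rw [← div_eq_mul_inv, div_le_div_iff₀ hn0 hμpos]
          calc _ = 2 * p * (D * μ n) := by ring
            _ ≤ _ := mul_le_mul_of_nonneg_left hle (by positivity)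
        linarith
      have hcard : (N.card : ℝ) * (p / R) ≤ p * D + p / R := by
        have hle : (N.card : ℝ) ≤ D * R + 1 := by
          have h3 : N.card ≤ ⌊D * R⌋₊ + 1 := by simp [hN]
          have h4 : ((⌊D * R⌋₊ : ℕ) : ℝ) ≤ D * R := Nat.floor_le (by positivity)
          have h5 : (N.card : ℝ) ≤ ((⌊D * R⌋₊ + 1 : ℕ) : ℝ) := by exact_mod_cast h3
          push_cast at h5
          linarith
        calc _ ≤ (D * R + 1) * (p / R) := by gcongr
          _ = _ := by field_simp
      have hpR1 : p / R ≤ 1 := (div_le_one hR).2 hpR.le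
      have hsum1 := hB R hR
      calc _ ≤ ∑ n ∈ N, (-(2 * p * D) * ((n : ℝ))⁻¹ + p / R) := Finset.sum_le_sum h1
        _ = -(2 * p * D * ∑ n ∈ N, ((n : ℝ))⁻¹) + N.card * (p / R) := by
          rw [Finset.sum_add_distrib, ← Finset.mul_sum, Finset.sum_const, nsmul_eq_mul, neg_mul]
        _ ≤ -(2 * p * D * (Real.log R - B)) + (p * D + p / R) := by gcongr
        _ ≤ _ := by linarith
    have hGp : 0 < ‖G p‖ := by
      rw [hGnorm]
      exact mul_pos (norm_pos_iff.2 hkp) (Real.exp_pos _)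
    have hlog : Real.log ‖G p‖ ≤
        Real.log C + (-(2 * p * D * (Real.log R - B)) + p * D + 1) := by
      rw [Real.log_le_iff_le_exp hGp, Real.exp_add, Real.exp_log hC]
      refine hmain.trans (mul_le_mul_of_nonneg_left (hprod.trans ?_) hC.le)
      exact Real.exp_le_exp.2 hsum
    -- Expanding L exposes the competing term -K p log R on the left.
    rw [hGnorm, Real.log_mul (norm_ne_zero_iff.2 hkp) (Real.exp_ne_zero _), Real.log_exp, hL,
      Real.log_mul two_ne_zero hR.ne', Complex.ofReal_re, Complex.ofReal_im, Complex.norm_real,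
      Real.norm_eq_abs, abs_of_pos hp] at hlog
    linarith
  have hcoef : 0 < (2 * D - K) * p := mul_pos (by linarith) hp
  obtain ⟨R, hR1, hR2⟩ := ((eventually_gt_atTop p).and
    ((Real.tendsto_log_atTop.const_mul_atTop hcoef).eventually_gt_atTop
      (Real.log C - Real.log ‖k p‖ - K * p * Real.log p + (T + c + K * Real.log 2) * p
        + 2 * p * D * B + p * D + 1))).exists
  exact absurd (key R hR1) (not_le.2 hR2)

/-- Carlson's theorem in the right half-plane for a function of exponential type whose zeros on the
positive half-line have lower density at least `D`, with growth rates `c₁`, `c₂` along the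
two halves of the imaginary axis satisfying `c₁ + c₂ < 2 π D`. -/
theorem eq_zero_of_positive_zeros {k : ℂ → ℂ} {C T c₁ c₂ D : ℝ}
    (hd : DifferentiableOn ℂ k {z | 0 < z.re}) (hc : ContinuousOn k {z | 0 ≤ z.re})
    (hT : ∀ z : ℂ, 0 ≤ z.re → ‖k z‖ ≤ C * Real.exp (T * ‖z‖))
    (hI₁ : ∀ y : ℝ, 0 ≤ y → ‖k (y * Complex.I)‖ ≤ C * Real.exp (c₁ * y))
    (hI₂ : ∀ y : ℝ, 0 ≤ y → ‖k (-(y * Complex.I))‖ ≤ C * Real.exp (c₂ * y))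
    (hc0 : 0 ≤ c₁ + c₂) (hcD : c₁ + c₂ < 2 * Real.pi * D)
    {μ : ℕ → ℝ} {n₀ : ℕ} (hinj : Set.InjOn μ (Set.Ici n₀)) (hμ0 : ∀ n, n₀ ≤ n → k (μ n) = 0)
    (hμD : ∀ n, n₀ ≤ n → D * μ n ≤ n)
    {p : ℝ} (hp : 0 < p) (hpμ : ∀ n, n₀ ≤ n → p < μ n) : k p = 0 := by
  have hC : 0 ≤ C := by simpa using (norm_nonneg _).trans (hT 0 (by simp))
  -- The factor e^{ibw} has modulus e^{-by}, which turns both rates into their mean.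
  set b : ℝ := (c₁ - c₂) / 2 with hb
  have hnorm : ∀ w : ℂ, ‖k w * Complex.exp (b * Complex.I * w)‖ =
      ‖k w‖ * Real.exp (-(b * w.im)) := by
    intro w
    rw [norm_mul, Complex.norm_exp]
    congr 2
    simp
  have h := eq_zero_of_positive_zeros_of_symmetric_growth
    (k := fun w => k w * Complex.exp (b * Complex.I * w)) (C := C) (T := T + |b|)
    (c := (c₁ + c₂) / 2) (D := D) (hd.mul (by fun_prop)) (hc.mul (by fun_prop))
    (fun w hw => by
      rw [hnorm]
      have h2 : -(b * w.im) ≤ |b| * ‖w‖ := by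
        refine (neg_le_abs _).trans ?_
        rw [abs_mul]
        exact mul_le_mul_of_nonneg_left (Complex.abs_im_le_norm w) (abs_nonneg _)
      calc _ ≤ C * Real.exp (T * ‖w‖) * Real.exp (|b| * ‖w‖) := by gcongr; exact hT w hw
        _ = _ := by rw [mul_assoc, ← Real.exp_add, add_mul])
    (fun y => by
      rw [hnorm]
      have him : ((y : ℂ) * Complex.I).im = y := by simp
      rw [him]
      rcases le_total 0 y with hy | hy
      · calc _ ≤ C * Real.exp (c₁ * y) * Real.exp (-(b * y)) := by gcongr; exact hI₁ y hy
          _ = _ := by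
            rw [mul_assoc, ← Real.exp_add, abs_of_nonneg hy, hb]
            congr 2; ring
      · have h1 := hI₂ (-y) (by linarith)
        rw [show -(((-y : ℝ) : ℂ) * Complex.I) = y * Complex.I by push_cast; ring] at h1
        calc _ ≤ C * Real.exp (c₂ * -y) * Real.exp (-(b * y)) := by gcongr
          _ = _ := by
            rw [mul_assoc, ← Real.exp_add, abs_of_nonpos hy, hb]
            congr 2; ring)
    (by linarith) (by linarith) hinj (fun n hn => by simp only [hμ0 n hn, zero_mul]) hμD hp hpμ
  exact (mul_eq_zero.1 h).resolve_right (Complex.exp_ne_zero _)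

/-! ### Global bounds from type and indicator -/

/-- A continuous function which is eventually at most `exp ∘ ψ` is everywhere at most a constant
multiple of it. -/
theorem exists_norm_le_mul_exp {X : Type*} [NormedAddCommGroup X] [ProperSpace X] {f : X → ℂ}
    {ψ : X → ℝ} (hf : Continuous f) (hψ : Continuous ψ) (S : Set X)
    (h : ∀ᶠ r : ℝ in atTop, ∀ x ∈ S, ‖x‖ = r → ‖f x‖ ≤ Real.exp (ψ x)) :
    ∃ C : ℝ, 1 ≤ C ∧ ∀ x ∈ S, ‖f x‖ ≤ C * Real.exp (ψ x) := by
  obtain ⟨R, hR⟩ := eventually_atTop.1 h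
  obtain ⟨B, hB⟩ := (isCompact_closedBall (0 : X) R).exists_bound_of_continuousOn
    (f := fun x => ‖f x‖ * Real.exp (-ψ x)) (by fun_prop)
  refine ⟨max 1 B, le_max_left _ _, fun x hx => ?_⟩
  rcases le_total R ‖x‖ with hxR | hxR
  · refine (hR ‖x‖ hxR x hx rfl).trans (le_mul_of_one_le_left (Real.exp_pos _).le (le_max_left _ _))
  · have h1 := (le_abs_self _).trans (hB x (by simpa using hxR))
    rw [Real.exp_neg, ← div_eq_mul_inv, div_le_iff₀ (Real.exp_pos _)] at h1
    exact h1.trans (mul_le_mul_of_nonneg_right (le_max_right _ _) (Real.exp_pos _).le)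

theorem exists_norm_le_of_entireType_lt_top {m : ℕ} {f : ℂ → ℂ} (hf : Continuous f)
    (htype : entireType (m : ℝ) f < ⊤) :
    ∃ C T : ℝ, 1 ≤ C ∧ ∀ z, ‖f z‖ ≤ C * Real.exp (T * ‖z‖ ^ m) := by
  obtain ⟨T, hT, -⟩ := EReal.lt_iff_exists_real_btwn.1 htype
  have hev := eventually_lt_of_limsup_lt hT
  obtain ⟨C, hC, h⟩ := exists_norm_le_mul_exp (ψ := fun z : ℂ => T * ‖z‖ ^ m) hf (by fun_prop)
    Set.univ (by
      filter_upwards [hev, eventually_gt_atTop 0] with r hr hr0 z _ hz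
      rw [EReal.coe_lt_coe_iff, Real.rpow_natCast, div_lt_iff₀ (by positivity)] at hr
      have hM : ‖f z‖ ≤ maxModulus f r := by
        refine le_csSup ?_ ⟨z, by simp [hz], rfl⟩
        exact ((isCompact_closedBall (0 : ℂ) r).image (by fun_prop)).bddAbove
      rw [hz]
      -- `Real.le_exp_log` needs no positivity, so a zero maximum modulus is covered.
      exact hM.trans ((Real.le_exp_log _).trans (Real.exp_le_exp.2 hr.le)))
  exact ⟨C, T, hC, fun z => h z trivial⟩

theorem exists_norm_le_of_indicatorFn_lt {m : ℕ} {f : ℂ → ℂ} (hf : Continuous f) {θ c : ℝ}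
    (hθ : indicatorFn (m : ℝ) f θ < c) :
    ∃ C : ℝ, 1 ≤ C ∧ ∀ r : ℝ, 0 ≤ r →
      ‖f (r * Complex.exp (θ * Complex.I))‖ ≤ C * Real.exp (c * r ^ m) := by
  have hev := eventually_lt_of_limsup_lt hθ
  refine exists_norm_le_mul_exp (f := fun r : ℝ => f (r * Complex.exp (θ * Complex.I)))
    (ψ := fun r : ℝ => c * r ^ m) (by fun_prop) (by fun_prop) (Set.Ici 0) ?_
  filter_upwards [hev, eventually_gt_atTop 0] with r hr hr0 x hx hxr
  have hxr' : x = r := by rwa [Real.norm_eq_abs, abs_of_nonneg hx] at hxr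
  subst hxr'
  have hpos : 0 < x ^ m := by positivity
  rw [Real.rpow_natCast, EReal.div_lt_iff (by exact_mod_cast hpos) (EReal.coe_ne_top _),
    ← EReal.coe_mul, ← ofReal_norm] at hr
  rcases (norm_nonneg (f (x * Complex.exp (θ * Complex.I)))).eq_or_lt with h0 | h0
  · rw [← h0]; positivity
  · rw [ENNReal.log_ofReal_of_pos h0, EReal.coe_lt_coe_iff] at hr
    exact ((Real.log_lt_iff_lt_exp h0).1 hr).le

/-- Finite type excludes +∞; otherwise ⊥ + ⊤ = ⊥ in `EReal` would make a bound on a sum of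
indicators say nothing about each one. -/
theorem indicatorFn_lt_top {m : ℕ} {f : ℂ → ℂ} (hf : Continuous f)
    (htype : entireType (m : ℝ) f < ⊤) (θ : ℝ) : indicatorFn (m : ℝ) f θ < ⊤ := by
  obtain ⟨C, T, hC, h⟩ := exists_norm_le_of_entireType_lt_top hf htype
  refine lt_of_le_of_lt (b := ((Real.log C + T : ℝ) : EReal)) ?_ (EReal.coe_lt_top _)
  refine limsup_le_of_le (by isBoundedDefault) ?_
  filter_upwards [eventually_ge_atTop 1] with r hr
  have hr1 : 1 ≤ r ^ m := one_le_pow₀ hr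
  have hr0 : 0 < r ^ m := by positivity
  rw [Real.rpow_natCast, EReal.div_le_iff_le_mul (by exact_mod_cast hr0) (EReal.coe_ne_top _),
    ← EReal.coe_mul, ← ofReal_norm]
  have h1 := h (r * Complex.exp (θ * Complex.I))
  rw [norm_mul, Complex.norm_exp_ofReal_mul_I, mul_one, Complex.norm_real, Real.norm_eq_abs,
    abs_of_nonneg (by linarith)] at h1
  have hpos : 0 < C * Real.exp (T * r ^ m) := by positivity
  refine (ENNReal.log_le_log (ENNReal.ofReal_le_ofReal h1)).trans ?_
  rw [ENNReal.log_ofReal_of_pos hpos, EReal.coe_le_coe_iff,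
    Real.log_mul (by positivity) (Real.exp_ne_zero _), Real.log_exp]
  nlinarith [Real.log_nonneg hC]

theorem EReal.exists_real_add_lt {x y : EReal} {b : ℝ} (hx : x < ⊤) (hy : y < ⊤)
    (h : x + y < b) : ∃ c d : ℝ, x < c ∧ y < d ∧ c + d < b := by
  induction x with
  | top => exact absurd hx (lt_irrefl _)
  | bot =>
    obtain ⟨d, hd, -⟩ := EReal.lt_iff_exists_real_btwn.1 hy
    exact ⟨b - d - 1, d, EReal.bot_lt_coe _, hd, by linarith⟩
  | coe x =>
    induction y with
    | top => exact absurd hy (lt_irrefl _)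
    | bot => exact ⟨x + 1, b - x - 2, by exact_mod_cast lt_add_one x, EReal.bot_lt_coe _, by linarith⟩
    | coe y =>
      have h' : x + y < b := by exact_mod_cast h
      refine ⟨x + (b - x - y) / 3, y + (b - x - y) / 3, ?_, ?_, by linarith⟩ <;>
        rw [EReal.coe_lt_coe_iff] <;> linarith

/-- D is chosen between (c + d)/(2π) and 1/A, or large enough if A = 0. Nonnegativity of c + d,
which Carlson's theorem requires, comes from enlarging the rates; for A > 0 this is harmless because
2π/A > 0. -/
theorem exists_growth_rates_and_density {x y : EReal} {A : ℝ} (hx : x < ⊤) (hy : y < ⊤)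
    (hA : 0 ≤ A) (h : 0 < A → x + y < ((2 * Real.pi / A : ℝ) : EReal)) :
    ∃ c d D : ℝ, x < c ∧ y < d ∧ 0 ≤ c + d ∧ c + d < 2 * Real.pi * D ∧ D * A < 1 := by
  have hpi := Real.pi_pos
  rcases hA.eq_or_lt with rfl | hA
  · obtain ⟨c, hc, -⟩ := EReal.lt_iff_exists_real_btwn.1 hx
    obtain ⟨d, hd, -⟩ := EReal.lt_iff_exists_real_btwn.1 hy
    refine ⟨max c 0, max d 0, (max c 0 + max d 0) / (2 * Real.pi) + 1,
      hc.trans_le (by exact_mod_cast le_max_left _ _),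
      hd.trans_le (by exact_mod_cast le_max_left _ _), by positivity, ?_, by simp⟩
    rw [mul_add, mul_div_cancel₀ _ (by positivity)]
    linarith
  · obtain ⟨c, d, hc, hd, hcd⟩ := EReal.exists_real_add_lt hx hy (h hA)
    have hcd' : max c (-d) + d < 2 * Real.pi / A := by
      rcases max_choice c (-d) with h | h <;> rw [h]
      · exact hcd
      · rw [neg_add_cancel]; positivity
    have : (max c (-d) + d) / (2 * Real.pi) < 1 / A := by
      rw [div_lt_iff₀ (by positivity)]
      calc _ < _ := hcd'
        _ = _ := by ring
    obtain ⟨D, hD1, hD2⟩ := exists_between this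
    refine ⟨max c (-d), d, D, hc.trans_le (by exact_mod_cast le_max_left _ _), hd, ?_, ?_, ?_⟩
    · linarith [le_max_right c (-d)]
    · rw [div_lt_iff₀ (by positivity)] at hD1; linarith
    · rwa [lt_div_iff₀ hA] at hD2

/-! ### The substitution w ↦ w^{1/m} and the conclusion -/

theorem ofReal_mul_I_cpow_inv_natCast {m : ℕ} (hm : m ≠ 0) {y : ℝ} (hy : 0 ≤ y) :
    ((y : ℂ) * Complex.I) ^ ((m : ℂ)⁻¹) =
      ((y ^ ((m : ℝ)⁻¹) : ℝ) : ℂ) * Complex.exp ((Real.pi / (2 * m) : ℝ) * Complex.I) := by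
  rw [Complex.ofReal_cpow hy]
  rcases hy.eq_or_lt with rfl | hy
  · simp [hm]
  have hm' : (m : ℂ) ≠ 0 := by exact_mod_cast hm
  have hy' : (y : ℂ) ≠ 0 := by exact_mod_cast hy.ne'
  rw [Complex.cpow_def_of_ne_zero (by simp [hy.ne']), Complex.cpow_def_of_ne_zero hy',
    ← Complex.exp_add, Complex.log_ofReal_mul hy Complex.I_ne_zero, Complex.log_I,
    Complex.ofReal_log hy.le]
  congr 1
  push_cast
  field_simp

theorem neg_ofReal_mul_I_cpow_inv_natCast {m : ℕ} (hm : m ≠ 0) {y : ℝ} (hy : 0 ≤ y) :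
    (-((y : ℂ) * Complex.I)) ^ ((m : ℂ)⁻¹) =
      ((y ^ ((m : ℝ)⁻¹) : ℝ) : ℂ) * Complex.exp ((-Real.pi / (2 * m) : ℝ) * Complex.I) := by
  rw [Complex.ofReal_cpow hy, ← mul_neg]
  rcases hy.eq_or_lt with rfl | hy
  · simp [hm]
  have hm' : (m : ℂ) ≠ 0 := by exact_mod_cast hm
  have hy' : (y : ℂ) ≠ 0 := by exact_mod_cast hy.ne'
  rw [Complex.cpow_def_of_ne_zero (by simp [hy.ne']), Complex.cpow_def_of_ne_zero hy',
    ← Complex.exp_add, Complex.log_ofReal_mul hy (neg_ne_zero.2 Complex.I_ne_zero),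
    Complex.log_neg_I, Complex.ofReal_log hy.le]
  congr 1
  push_cast
  field_simp

/-- An entire function vanishing on an open interval of the real line vanishes identically. -/
theorem Differentiable.eq_zero_of_eq_zero_on_Ioo {f : ℂ → ℂ} (hf : Differentiable ℂ f) {u v : ℝ}
    (huv : u < v) (h : ∀ x ∈ Set.Ioo u v, f x = 0) (z : ℂ) : f z = 0 := by
  have ha : AnalyticOnNhd ℂ f Set.univ := fun w _ => hf.analyticAt w
  have hx : Set.Ioo u v ∈ 𝓝 ((u + v) / 2) := Ioo_mem_nhds (by linarith) (by linarith)
  have hlim : Tendsto (fun x : ℝ => (x : ℂ)) (𝓝[≠] ((u + v) / 2)) (𝓝[≠] (((u + v) / 2 : ℝ) : ℂ)) :=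
    Complex.continuous_ofReal.continuousAt.continuousWithinAt.tendsto_nhdsWithin
      fun x hx hxe => hx (Complex.ofReal_injective hxe)
  have hev : ∀ᶠ x : ℝ in 𝓝[≠] ((u + v) / 2), f x = (0 : ℂ → ℂ) x := by
    filter_upwards [nhdsWithin_le_nhds hx] with x hx using h x hx
  exact congrFun (ha.eq_of_frequently_eq (fun w _ => analyticAt_const)
    (hlim.frequently hev.frequently)) z

theorem lemma3p6 (m : ℕ) (hm : 1 ≤ m) (f : ℂ → ℂ)
    (hf : Differentiable ℂ f)
    (horder : entireOrder f ≤ (m : EReal))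
    (htype : entireType (m : ℝ) f < ⊤)
    (lam : ℕ → ℝ)
    (hmono : StrictMonoOn lam (Set.Ici 1))
    (hpos : ∀ n : ℕ, 1 ≤ n → 0 < lam n)
    (a : ℝ)
    (hlim : Tendsto (fun n : ℕ => lam n / (n : ℝ) ^ (1 / (m : ℝ))) atTop (𝓝 a))
    (hzero : ∀ n : ℕ, 1 ≤ n → ∀ l : ℕ, l ≤ m - 1 →
      f ((lam n : ℂ) * Complex.exp (2 * (l : ℂ) * (Real.pi : ℂ) * Complex.I / (m : ℂ))) = 0)
    -- for `a = 0` the bound `2π / a ^ m` is read as `+∞`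
    (hsum : 0 < a →
      (⨆ l : Fin m, indicatorFn (m : ℝ) f ((4 * ((l : ℕ) : ℝ) + 1) * Real.pi / (2 * (m : ℝ)))) +
      (⨆ l : Fin m, indicatorFn (m : ℝ) f ((4 * ((l : ℕ) : ℝ) - 1) * Real.pi / (2 * (m : ℝ)))) <
        ((2 * Real.pi / a ^ m : ℝ) : EReal)) :
    ∀ z : ℂ, f z = 0 := by
  have hm0 : m ≠ 0 := by omega
  have hfc := hf.continuous
  have ha : 0 ≤ a := by
    refine ge_of_tendsto hlim ?_
    filter_upwards [eventually_ge_atTop 1] with n hn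
    have := hpos n hn
    positivity
  -- only the indicators in the directions `± π / (2 m)` are needed
  obtain ⟨c₁, c₂, D, hc₁, hc₂, hc0, hcD, hDa⟩ := exists_growth_rates_and_density (A := a ^ m)
    (indicatorFn_lt_top hfc htype (Real.pi / (2 * m)))
    (indicatorFn_lt_top hfc htype (-Real.pi / (2 * m))) (by positivity) (by
      intro h
      have ha' : 0 < a := ha.lt_of_ne fun h0 => by simp [← h0, hm0] at h
      refine lt_of_le_of_lt (add_le_add ?_ ?_) (hsum ha')
      · refine le_trans (le_of_eq ?_) (le_iSup _ (⟨0, hm⟩ : Fin m))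
        simp
      · refine le_trans (le_of_eq ?_) (le_iSup _ (⟨0, hm⟩ : Fin m))
        simp)
  obtain ⟨C, T, hC, hT⟩ := exists_norm_le_of_entireType_lt_top hfc htype
  obtain ⟨C₁, hC₁, h₁⟩ := exists_norm_le_of_indicatorFn_lt hfc hc₁
  obtain ⟨C₂, hC₂, h₂⟩ := exists_norm_le_of_indicatorFn_lt hfc hc₂
  set C' : ℝ := C + C₁ + C₂ with hC'
  have hroot : ∀ x : ℝ, 0 ≤ x → (((x ^ m : ℝ) : ℂ)) ^ ((m : ℂ)⁻¹) = x := by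
    intro x hx
    have h := Complex.ofReal_cpow (pow_nonneg hx m) ((m : ℝ)⁻¹)
    rw [Real.pow_rpow_inv_natCast hx hm0] at h
    rw [h]; push_cast; rfl
  have hre : 0 < ((m : ℂ)⁻¹).re := by
    rw [← Complex.ofReal_natCast, ← Complex.ofReal_inv, Complex.ofReal_re]
    positivity
  -- D λ_n^m / n tends to D a^m < 1.
  have hdens : ∀ᶠ n : ℕ in atTop, D * lam n ^ m ≤ n := by
    have h1 : Tendsto (fun n : ℕ => D * (lam n / (n : ℝ) ^ (1 / (m : ℝ))) ^ m) atTop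
        (𝓝 (D * a ^ m)) := (hlim.pow m).const_mul D
    filter_upwards [h1.eventually_lt_const hDa, eventually_ge_atTop 1] with n hn hn1
    have hn0 : (0 : ℝ) < n := by exact_mod_cast hn1
    rw [div_pow, one_div, Real.rpow_inv_natCast_pow hn0.le hm0, ← mul_div_assoc,
      div_lt_one hn0] at hn
    exact hn.le
  obtain ⟨n₁, hn₁⟩ := eventually_atTop.1 hdens
  have hge : ∀ n, max n₁ 1 ≤ n → 1 ≤ n := fun n hn => (le_max_right _ _).trans hn
  -- For 0 < x < λ_1 the point p = x^m lies below every μ_n, as the Blaschke estimate requires.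
  refine hf.eq_zero_of_eq_zero_on_Ioo (hpos 1 le_rfl) fun x hx => ?_
  have hk := eq_zero_of_positive_zeros (k := fun w => f (w ^ ((m : ℂ)⁻¹))) (C := C') (T := T)
    (c₁ := c₁) (c₂ := c₂) (D := D) (μ := fun n => lam n ^ m) (n₀ := max n₁ 1) (p := x ^ m)
    (hf.comp_differentiableOn (differentiableOn_id.cpow_const fun w hw => Or.inl hw))
    (hfc.comp_continuousOn fun w hw =>
      (Complex.continuousAt_cpow_const_of_re_pos (Or.inl hw) hre).continuousWithinAt)
    (fun w _ => by
      refine (hT _).trans ?_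
      rw [← norm_pow, Complex.cpow_nat_inv_pow w hm0]
      gcongr
      linarith)
    (fun y hy => by
      simp only [ofReal_mul_I_cpow_inv_natCast hm0 hy]
      refine (h₁ _ (by positivity)).trans ?_
      rw [Real.rpow_inv_natCast_pow hy hm0]
      gcongr
      linarith)
    (fun y hy => by
      simp only [neg_ofReal_mul_I_cpow_inv_natCast hm0 hy]
      refine (h₂ _ (by positivity)).trans ?_
      rw [Real.rpow_inv_natCast_pow hy hm0]
      gcongr
      linarith)
    hc0 hcD
    (fun i hi j hj hij => hmono.injOn (hge i hi) (hge j hj)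
      ((pow_left_inj₀ (hpos i (hge i hi)).le (hpos j (hge j hj)).le hm0).1 hij))
    (fun n hn => by
      simp only [hroot _ (hpos n (hge n hn)).le]
      simpa using hzero n (hge n hn) 0 (Nat.zero_le _))
    (fun n hn => hn₁ n ((le_max_left _ _).trans hn))
    (pow_pos hx.1 m)
    (fun n hn => by
      have h1 : lam 1 ≤ lam n := hmono.monotoneOn (Set.mem_Ici.2 le_rfl) (hge n hn) (hge n hn)
      exact pow_lt_pow_left₀ (hx.2.trans_le h1) hx.1.le hm0)
  simpa only [hroot x hx.1.le] using hk
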